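/- **Setting.** Let $D\subset\mathbb R^d$ be a bounded open set (a coarse-grid element $D_H^m$) and let $p^1,\dots,p^L$ be boundary data on $\partial D$, each given as the boundary values of a function in $H^1(D)$. Let $(\Omega,\mathcal F,P)$ be a probability space and let $\kappa(x,\omega)$ be a jointly measurable, symmetric-matrix-valued random coefficient with $\alpha I\le\kappa(x,\omega)\le\kappa_{\max}I$ for a.e. $x\in D$ and $\omega\in\Omega$, where $\alpha>0$; put $\bar\kappa(x)=\mathbb E[\kappa(x,\cdot)]$. For a coefficient $A$ write $\langle u,v\rangle_A=\int_D A\nabla u\cdot\nabla v\,dx$ and $\|u\|_{H_0^1(D;A)}=\langle u,u\rangle_A^{1/2}$. For almost every $\omega$ let $\phi^{l}(\cdot,\omega)\in H^1(D)$ be the weak solution of $$-\nabla\cdot(\kappa(x,\omega)\nabla\phi^{l})=0\ \text{ in }D,\qquad \phi^{l}=p^{l}\ \text{ on }\partial D,$$ measurable as a map of $\omega$ into $H^1(D)$, and let $\bar\phi^{l}=\mathbb E[\phi^{l}]$. Let $\lambda^{l}_1\ge\lambda^{l}_2\ge\cdots$ and $\zeta^{l,1},\zeta^{l,2},\dots$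 be the Karhunen–Loève energies and modes of $\phi^{l}-\bar\phi^{l}$ in $L^2(\Omega;H_0^1(D;\bar\kappa))$, i.e. the $\zeta^{l,q}\in H^1_0(D)$ are orthonormal for $\langle\cdot,\cdot\rangle_{\bar\kappa}$ and are eigenvectors, with eigenvalues $\lambda^{l}_q$, of the covariance operator of $\phi^{l}$, which vanishes on their orthogonal complement. For $Q\ge 0$ take the first $Q$ modes as reduced basis and let $$\phi^{l}_{rb}(x,\omega)=\bar\phi^{l}(x)+\sum_{q=1}^Q c^{l}_q(\omega)\,\zeta^{l,q}(x),\qquad \sum_{q'=1}^Q\langle\zeta^{l,q},\zeta^{l,q'}\rangle_{\kappa(\cdot,\omega)}\,c^{l}_{q'}(\omega)=-\langle\bar\phi^{l},\zeta^{l,q}\rangle_{\kappa(\cdot,\omega)}\quad(1\le q\le Q)$$ be the Galerkin reduced-basis solution, for almost every $\omega$. Put $S_{ll'}(\omega)=\langle\phi^{l},\phi^{l'}\rangle_{\kappa(\cdot,\omega)}$ and $\hat S_{ll'}(\omega)=\langle\phi_{rb}^{l},\phi_{rb}^{l'}\rangle_{\kappa(\cdot,\omega)}$. **Theorem.** There is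 a constant $C_\phi>0$, depending only on $D$ and on the boundary data $p^{l}$, such that always $\|\phi^{l}(\cdot,\omega)\|_{H_0^1(D;\kappa)}\le C_\phi\sqrt{\kappa_{\max}}$ almost surely, and such that the following holds. Assume that 1. there are $C_1>0$ and $\beta>1$ with $\lambda^{l}_j\le C_1\beta^{-j}$ for all $j\ge1$ and all $l$, and 2. there is a constant $C_2$ with $\kappa(x,\omega)\le C_2\,\bar\kappa(x)$ (as symmetric matrices) for a.e. $x\in D$ and almost all $\omega$. Then for every $\varepsilon>0$ and every $l$, $$P\left[\|\phi^{l}-\phi^{l}_{rb}\|_{H_0^1(D;\kappa)}\ge\varepsilon\right]\le\frac{C_1C_2^2\beta^{-Q}}{(\beta-1)\varepsilon^2},$$ and for every $0<\varepsilon\le 2C_\phi\sqrt{\kappa_{\max}}$ and all $l,l'$, $$P\left[|S_{ll'}-\hat S_{ll'}|\ge 2C_\phi\sqrt{\kappa_{\max}}\,\varepsilon\right]\le\frac{2C_1C_2^2\beta^{-Q}}{(\beta-1)\varepsilon^2}.$$ -/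

import Mathlib

open MeasureTheory

noncomputable section

namespace StoMsFEM

/-- Physical space `ℝ^d` with its Euclidean norm. -/
abbrev Space (d : ℕ) := EuclideanSpace ℝ (Fin d)

/-- Pairs `(u, G)` of a function `u ∈ L²(D)` and a vector field `G ∈ L²(D; ℝ^d)`, with the Hilbert
norm `(‖u‖² + ‖G‖²)^{1/2}`.  A Sobolev function `u` is represented by the pair `(u, ∇u)`, so that
the norm of the pair is the `H¹(D)` norm of `u`. -/
abbrev Pair (d : ℕ) (D : Set (Space d)) :=
  WithLp 2 (Lp ℝ 2 (volume.restrict D) × Lp (Space d) 2 (volume.restrict D))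

variable {d : ℕ} {D : Set (Space d)}

/-- The function component `u` of a pair `(u, ∇u)`. -/
def val (w : Pair d D) : Space d → ℝ := w.fst

/-- The gradient component `∇u` of a pair `(u, ∇u)`. -/
def grad (w : Pair d D) : Space d → Space d := w.snd

/-- Test functions: smooth with compact support contained in `D`. -/
def IsTest (D : Set (Space d)) (θ : Space d → ℝ) : Prop :=
  ContDiff ℝ ((⊤ : ℕ∞) : WithTop ℕ∞) θ ∧ HasCompactSupport θ ∧ tsupport θ ⊆ D

/-- The pair belongs to `H¹(D)`: its second component is the weak gradient of its first one. -/
def MemH1 (w : Pair d D) : Prop :=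
  ∀ θ : Space d → ℝ, IsTest D θ →
    ∫ x in D, val w x • gradient θ x = - ∫ x in D, θ x • grad w x

/-- `H¹₀(D)`: the closure in the `H¹` norm of the pairs `(θ, ∇θ)` with `θ ∈ C_c^∞(D)`. -/
def H10 (D : Set (Space d)) : Submodule ℝ (Pair d D) :=
  (Submodule.span ℝ {w : Pair d D | ∃ θ : Space d → ℝ, IsTest D θ ∧
    val w =ᵐ[volume.restrict D] θ ∧
    grad w =ᵐ[volume.restrict D] gradient θ}).topologicalClosure

/-- A (deterministic, matrix-valued) coefficient field on `ℝ^d`. -/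
abbrev Coeff (d : ℕ) := Space d → Matrix (Fin d) (Fin d) ℝ

/-- The bilinear form `∫_D A ∇u · ∇v dx`. -/
def energy (A : Coeff d) (u v : Pair d D) : ℝ :=
  ∫ x in D, (A x).mulVec (grad u x).ofLp ⬝ᵥ (grad v x).ofLp

/-- The norm `(∫_D A ∇u · ∇u dx)^{1/2}` of `H¹₀(D; A)`. -/
def energyNorm (A : Coeff d) (u : Pair d D) : ℝ := √(energy A u u)

/-- `u` is the weak solution of `-∇·(A∇u) = 0` in `D` with `u = g` on `∂D`
(boundary values are prescribed as those of the `H¹(D)` function `g`). -/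
structure IsCellSolution (A : Coeff d) (g u : Pair d D) : Prop where
  boundary : u - g ∈ H10 D
  weak : ∀ v ∈ H10 D, energy A u v = 0

section Random

variable {Ω : Type*} [MeasurableSpace Ω]

/-- A random coefficient `κ(x, ω)`: jointly measurable and, for almost all `ω` and `x ∈ D`,
symmetric with `α I ≤ κ(x, ω) ≤ κmax I`, where `α > 0`. -/
structure IsRandomCoeff (P : Measure Ω) (D : Set (Space d)) (κ : Ω → Coeff d)
    (α κmax : ℝ) : Prop where
  measurable : ∀ i j, Measurable fun z : Ω × Space d => κ z.1 z.2 i j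
  pos : 0 < α
  lower : ∀ᵐ ω ∂P, ∀ᵐ x ∂(volume.restrict D),
    (κ ω x - α • (1 : Matrix (Fin d) (Fin d) ℝ)).PosSemidef
  upper : ∀ᵐ ω ∂P, ∀ᵐ x ∂(volume.restrict D),
    (κmax • (1 : Matrix (Fin d) (Fin d) ℝ) - κ ω x).PosSemidef

/-- The mean coefficient `κ̄(x) = E[κ(x, ·)]`, entry by entry. -/
def meanCoeff (P : Measure Ω) (κ : Ω → Coeff d) : Coeff d :=
  fun x => Matrix.of fun i j => ∫ ω, κ ω x i j ∂P

/-- The mean `∫ φ(·, ω) dP(ω)` of a random Sobolev function. -/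
def meanField (P : Measure Ω) (φ : Ω → Pair d D) : Pair d D := ∫ ω, φ ω ∂P

/-- The covariance form of `φ` with respect to the inner product `⟨u, v⟩ = ∫_D A ∇u · ∇v`:
`Cov(u, v) = E[⟨φ - φ̄, u⟩ ⟨φ - φ̄, v⟩]`. -/
def covForm (P : Measure Ω) (A : Coeff d) (φ : Ω → Pair d D) (u v : Pair d D) : ℝ :=
  ∫ ω, energy A (φ ω - meanField P φ) u * energy A (φ ω - meanField P φ) v ∂P

/-- `(lam q, ζ q)`, `q = 0, 1, 2, …`, are the Karhunen-Loève energies and modes of `φ` in the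
Hilbert space `H¹₀(D; A)`: orthonormal eigenvectors of the covariance operator, with eigenvalues
in descending order, which exhaust the covariance (it vanishes on their orthogonal complement). -/
structure IsKL (P : Measure Ω) (A : Coeff d) (φ : Ω → Pair d D)
    (lam : ℕ → ℝ) (ζ : ℕ → Pair d D) : Prop where
  mem : ∀ q, ζ q ∈ H10 D
  orthonormal : ∀ q r, energy A (ζ q) (ζ r) = if q = r then 1 else 0
  antitone : Antitone lam
  eigen : ∀ q, ∀ v ∈ H10 D, covForm P A φ (ζ q) v = lam q * energy A (ζ q) v
  exhaust : ∀ v ∈ H10 D, (∀ q, energy A (ζ q) v = 0) → covForm P A φ v v = 0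

end Random

/-- The Galerkin matrix with entries `∫_D A ∇ζ_q · ∇ζ_q'`, for the first `Q` modes. -/
def galerkinMatrix (A : Coeff d) (ζ : ℕ → Pair d D) (Q : ℕ) : Matrix (Fin Q) (Fin Q) ℝ :=
  Matrix.of fun q q' => energy A (ζ q) (ζ q')

/-- The Galerkin load vector with entries `-∫_D A ∇φ̄ · ∇ζ_q`. -/
def galerkinLoad (A : Coeff d) (ζ : ℕ → Pair d D) (φbar : Pair d D) (Q : ℕ) : Fin Q → ℝ :=
  fun q => - energy A φbar (ζ q)

/-- The reduced-basis function `φ̄ + ∑_{q < Q} c_q ζ_q`. -/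
def reducedBasisFun (ζ : ℕ → Pair d D) (φbar : Pair d D) {Q : ℕ} (c : Fin Q → ℝ) : Pair d D :=
  φbar + ∑ q : Fin Q, c q • ζ q

end StoMsFEM

end

noncomputable section

namespace StoMsFEM

/-! Fix `ω`. The Galerkin solution minimizes the `κ(·, ω)`-energy of the error over `φ̄ + span(ζ_q :
q < Q)`, so its error is at most that of the truncated Karhunen-Loève expansion. The bound `κ ≤ C₂
κ̄` moves this error to the `κ̄`-energy at the cost of a factor `C₂`. There Parseval bounds it by
the sum of the squared coefficients of index at least `Q` (`klTail`), whose expectation is the sum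
of the remaining eigenvalues (`lintegral_klTail`), at most `C₁ β^(-Q) / (β - 1)`. Markov's
inequality gives the error estimate with `C₂`, and `1 ≤ C₂` weakens it to `C₂ ^ 2`.

Parseval needs almost every realization of `φ - φ̄` to lie in the closed span of the modes, while
the hypothesis only says that the covariance vanishes on their complement. `ae_mem_closure_span`
bridges the gap by separability and Lax-Milgram; the coercivity it needs comes from Poincaré's
inequality (`norm_fst_le_of_mem_H10`).

For the stiffness entries, `S - Ŝ = -⟨e, e'⟩_κ` with `e`, `e'` the two errors
(`energy_sub_energy_eq`). By Cauchy-Schwarz a deviation of `2 Cφ √κmax ε ≥ ε²` forces one error to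
be at least `ε`, and the union bound doubles the probability. The constant `Cφ` comes from energy
minimization by the weak solution. -/

/-- The entries of the coefficient are a.e. measurable and essentially bounded on `D`. -/
structure IsBddCoeff {d : ℕ} (D : Set (Space d)) (A : Coeff d) (M : ℝ) : Prop where
  aestronglyMeasurable : ∀ i j, AEStronglyMeasurable (fun x => A x i j) (volume.restrict D)
  bound : ∀ i j, ∀ᵐ x ∂(volume.restrict D), |A x i j| ≤ M

theorem memLp_grad_apply {d : ℕ} {D : Set (Space d)} (u : Pair d D) (i : Fin d) :
    MemLp (fun x => grad u x i) 2 (volume.restrict D) := by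
  have h : MemLp (grad u) 2 (volume.restrict D) := Lp.memLp _
  exact h.of_le ((PiLp.continuous_apply 2 _ i).comp_aestronglyMeasurable h.1)
    (.of_forall fun x => PiLp.norm_apply_le _ i)

theorem integrable_grad_mul_grad {d : ℕ} {D : Set (Space d)} (u v : Pair d D) (i j : Fin d) :
    Integrable (fun x => grad u x j * grad v x i) (volume.restrict D) :=
  (memLp_grad_apply u j).integrable_mul (memLp_grad_apply v i)

theorem mulVec_dotProduct_eq_sum {d : ℕ} (A : Matrix (Fin d) (Fin d) ℝ) (a b : Fin d → ℝ) :
    A.mulVec a ⬝ᵥ b = ∑ i, ∑ j, A i j * (a j * b i) := by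
  simp only [dotProduct, Matrix.mulVec, Finset.sum_mul, mul_assoc]

/-! ### The energy form of a bounded coefficient -/

section Deterministic

variable {d : ℕ} {D : Set (Space d)} {A B : Coeff d} {M M' : ℝ}

theorem IsBddCoeff.integrable_entry (hA : IsBddCoeff D A M) (u v : Pair d D) (i j : Fin d) :
    Integrable (fun x => A x i j * (grad u x j * grad v x i)) (volume.restrict D) :=
  (integrable_grad_mul_grad u v i j).bdd_mul (hA.aestronglyMeasurable i j) (hA.bound i j)

theorem IsBddCoeff.integrable (hA : IsBddCoeff D A M) (u v : Pair d D) :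
    Integrable (fun x => (A x).mulVec (grad u x).ofLp ⬝ᵥ (grad v x).ofLp)
      (volume.restrict D) := by
  simp only [mulVec_dotProduct_eq_sum]
  exact integrable_finsetSum _ fun i _ => integrable_finsetSum _ fun j _ =>
    hA.integrable_entry u v i j

theorem IsBddCoeff.energy_eq_sum (hA : IsBddCoeff D A M) (u v : Pair d D) :
    energy A u v = ∑ i, ∑ j, ∫ x in D, A x i j * (grad u x j * grad v x i) := by
  simp only [energy, mulVec_dotProduct_eq_sum]
  rw [integral_finsetSum _ fun i _ => integrable_finsetSum _ fun j _ => hA.integrable_entry u v i j]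
  exact Finset.sum_congr rfl fun i _ => integral_finsetSum _ fun j _ => hA.integrable_entry u v i j

theorem grad_add (u v : Pair d D) :
    grad (u + v) =ᵐ[volume.restrict D] fun x => grad u x + grad v x :=
  Lp.coeFn_add u.snd v.snd

theorem grad_smul (c : ℝ) (u : Pair d D) :
    grad (c • u) =ᵐ[volume.restrict D] fun x => c • grad u x :=
  Lp.coeFn_smul c u.snd

theorem IsBddCoeff.energy_add_left (hA : IsBddCoeff D A M) (u u' v : Pair d D) :
    energy A (u + u') v = energy A u v + energy A u' v := by
  rw [energy, energy, energy, ← integral_add (hA.integrable u v) (hA.integrable u' v)]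
  refine integral_congr_ae ?_
  filter_upwards [grad_add u u'] with x hx
  simp [hx, Matrix.mulVec_add, add_dotProduct]

theorem IsBddCoeff.energy_add_right (hA : IsBddCoeff D A M) (u v v' : Pair d D) :
    energy A u (v + v') = energy A u v + energy A u v' := by
  rw [energy, energy, energy, ← integral_add (hA.integrable u v) (hA.integrable u v')]
  refine integral_congr_ae ?_
  filter_upwards [grad_add v v'] with x hx
  simp [hx, dotProduct_add]

theorem energy_smul_left (c : ℝ) (u v : Pair d D) :
    energy A (c • u) v = c * energy A u v := by
  rw [energy, energy, ← integral_const_mul]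
  refine integral_congr_ae ?_
  filter_upwards [grad_smul c u] with x hx
  simp [hx, Matrix.mulVec_smul]

theorem energy_smul_right (c : ℝ) (u v : Pair d D) :
    energy A u (c • v) = c * energy A u v := by
  rw [energy, energy, ← integral_const_mul]
  refine integral_congr_ae ?_
  filter_upwards [grad_smul c v] with x hx
  simp [hx]

/-- The energy of a bounded coefficient as a bilinear form. -/
def IsBddCoeff.form (hA : IsBddCoeff D A M) : LinearMap.BilinForm ℝ (Pair d D) :=
  LinearMap.mk₂ ℝ (energy A) hA.energy_add_left energy_smul_left hA.energy_add_right
    energy_smul_right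

@[simp]
theorem IsBddCoeff.form_apply (hA : IsBddCoeff D A M) (u v : Pair d D) :
    hA.form u v = energy A u v := rfl

theorem IsBddCoeff.energy_le_energy (hA : IsBddCoeff D A M) (hB : IsBddCoeff D B M')
    (h : ∀ᵐ x ∂(volume.restrict D), (B x - A x).PosSemidef) (u : Pair d D) :
    energy A u u ≤ energy B u u := by
  refine integral_mono_ae (hA.integrable u u) (hB.integrable u u) ?_
  filter_upwards [h] with x hx
  have := hx.dotProduct_mulVec_nonneg (grad u x).ofLp
  rw [star_trivial, dotProduct_comm, Matrix.sub_mulVec, sub_dotProduct] at this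
  linarith

theorem energy_comm (h : ∀ᵐ x ∂(volume.restrict D), (A x).IsHermitian) (u v : Pair d D) :
    energy A u v = energy A v u := by
  refine integral_congr_ae ?_
  filter_upwards [h] with x hx
  have hT : (A x).transpose = A x := (Matrix.conjTranspose_eq_transpose_of_trivial (A x)).symm.trans hx
  conv_lhs => rw [← hT, Matrix.mulVec_transpose]
  rw [← Matrix.dotProduct_mulVec, dotProduct_comm]

theorem isBddCoeff_const (c : ℝ) :
    IsBddCoeff D (fun _ => c • (1 : Matrix (Fin d) (Fin d) ℝ)) |c| where
  aestronglyMeasurable _ _ := aestronglyMeasurable_const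
  bound i j := .of_forall fun x => by
    by_cases h : i = j <;> simp [h]

theorem energy_const (c : ℝ) (u : Pair d D) :
    energy (fun _ => c • (1 : Matrix (Fin d) (Fin d) ℝ)) u u = c * ‖u.snd‖ ^ 2 := by
  rw [← real_inner_self_eq_norm_sq, L2.inner_def, ← integral_const_mul, energy]
  refine integral_congr_ae (.of_forall fun x => ?_)
  simp only [Matrix.smul_mulVec, Matrix.one_mulVec, smul_dotProduct, smul_eq_mul]
  rfl

theorem IsBddCoeff.const_smul (hA : IsBddCoeff D A M) (c : ℝ) :
    IsBddCoeff D (fun x => c • A x) (|c| * M) where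
  aestronglyMeasurable i j := (hA.aestronglyMeasurable i j).const_smul c
  bound i j := by
    filter_upwards [hA.bound i j] with x hx
    simpa [abs_mul] using mul_le_mul_of_nonneg_left hx (abs_nonneg c)

theorem energy_const_smul (c : ℝ) (u v : Pair d D) :
    energy (fun x => c • A x) u v = c * energy A u v := by
  rw [energy, energy, ← integral_const_mul]
  exact integral_congr_ae (.of_forall fun x => by simp [Matrix.smul_mulVec])

end Deterministic

/-- Positivity on `e_i ± e_j` gives `2 |A i j| ≤ A i i + A j j`, and each diagonal entry is at most
`M`. -/
theorem abs_apply_le_of_posSemidef {n : Type*} [Fintype n] [DecidableEq n] {A : Matrix n n ℝ}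
    {M : ℝ} (hA : A.PosSemidef) (hM : (M • (1 : Matrix n n ℝ) - A).PosSemidef) (i j : n) :
    |A i j| ≤ M := by
  have hdiag : ∀ i, A i i ≤ M := fun i => by
    simpa using hM.diag_nonneg (i := i)
  have hsymm : A j i = A i j := by simpa using hA.1.apply i j
  have key : ∀ c : ℝ, 0 ≤ A i i + c * A i j + c * A j i + c ^ 2 * A j j := fun c => by
    have := hA.dotProduct_mulVec_nonneg (Pi.single i 1 + c • Pi.single j 1)
    simp [Matrix.mulVec_add, Matrix.mulVec_smul] at this
    linarith
  have h1 := key 1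
  have h2 := key (-1)
  have h3 := hdiag i
  have h4 := hdiag j
  rw [hsymm] at h1 h2
  exact abs_le.2 ⟨by linarith, by linarith⟩

/-! ### Random coefficients and their mean -/

section Random

variable {d : ℕ} {D : Set (Space d)} {Ω : Type*} [MeasurableSpace Ω] {P : Measure Ω}
  {κ : Ω → Coeff d} {α κmax : ℝ}

namespace IsRandomCoeff

theorem ae_posSemidef (h : IsRandomCoeff P D κ α κmax) :
    ∀ᵐ ω ∂P, ∀ᵐ x ∂(volume.restrict D), (κ ω x).PosSemidef := by
  filter_upwards [h.lower] with ω hω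
  filter_upwards [hω] with x hx
  have := hx.add (Matrix.PosSemidef.one.smul h.pos.le (R := ℝ))
  simpa using this

theorem ae_abs_le (h : IsRandomCoeff P D κ α κmax) :
    ∀ᵐ ω ∂P, ∀ᵐ x ∂(volume.restrict D), ∀ i j, |κ ω x i j| ≤ κmax := by
  filter_upwards [h.ae_posSemidef, h.upper] with ω h1 h2
  filter_upwards [h1, h2] with x h1 h2
  exact abs_apply_le_of_posSemidef h1 h2

theorem ae_isBddCoeff (h : IsRandomCoeff P D κ α κmax) :
    ∀ᵐ ω ∂P, IsBddCoeff D (κ ω) κmax := by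
  filter_upwards [h.ae_abs_le] with ω hω
  exact ⟨fun i j => ((h.measurable i j).comp measurable_prodMk_left).aestronglyMeasurable,
    fun i j => hω.mono fun x hx => hx i j⟩

theorem measurableSet_abs_le (h : IsRandomCoeff P D κ α κmax) :
    MeasurableSet {z : Ω × Space d | ∀ i j, |κ z.1 z.2 i j| ≤ κmax} := by
  simp only [Set.ofPred_forall]
  exact .iInter fun i => .iInter fun j =>
    measurableSet_le (h.measurable i j).abs measurable_const

theorem ae_prod_abs_le [SFinite P] (h : IsRandomCoeff P D κ α κmax) :
    ∀ᵐ z ∂(P.prod (volume.restrict D)), ∀ i j, |κ z.1 z.2 i j| ≤ κmax :=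
  (Measure.ae_prod_iff_ae_ae h.measurableSet_abs_le).2 h.ae_abs_le

theorem isBddCoeff_meanCoeff [IsProbabilityMeasure P] (h : IsRandomCoeff P D κ α κmax) :
    IsBddCoeff D (meanCoeff P κ) κmax where
  aestronglyMeasurable i j :=
    (h.measurable i j).stronglyMeasurable.integral_prod_left'.aestronglyMeasurable
  bound i j := by
    have := (Measure.ae_ae_comm h.measurableSet_abs_le).1 h.ae_abs_le
    filter_upwards [this] with x hx
    simpa [meanCoeff] using norm_integral_le_of_norm_le_const (μ := P) (f := fun ω => κ ω x i j)
      (hx.mono fun ω hω => hω i j)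

theorem integrable_prod_entry [IsProbabilityMeasure P] (h : IsRandomCoeff P D κ α κmax)
    (u v : Pair d D) (i j : Fin d) :
    Integrable (fun z : Ω × Space d => κ z.1 z.2 i j * (grad u z.2 j * grad v z.2 i))
      (P.prod (volume.restrict D)) :=
  ((integrable_grad_mul_grad u v i j).comp_snd P).bdd_mul
    (h.measurable i j).aestronglyMeasurable (h.ae_prod_abs_le.mono fun _ hz => hz i j)

theorem ae_energy_eq_sum (h : IsRandomCoeff P D κ α κmax) (u v : Pair d D) :
    (fun ω => energy (κ ω) u v) =ᵐ[P]
      fun ω => ∑ i, ∑ j, ∫ x in D, κ ω x i j * (grad u x j * grad v x i) := by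
  filter_upwards [h.ae_isBddCoeff] with ω hω
  exact hω.energy_eq_sum u v

theorem integrable_energy [IsProbabilityMeasure P] (h : IsRandomCoeff P D κ α κmax)
    (u v : Pair d D) : Integrable (fun ω => energy (κ ω) u v) P := by
  refine Integrable.congr ?_ (h.ae_energy_eq_sum u v).symm
  exact integrable_finsetSum _ fun i _ => integrable_finsetSum _ fun j _ =>
    (h.integrable_prod_entry u v i j).integral_prod_left

/-- The energy of the mean coefficient is the mean of the energies. -/
theorem energy_meanCoeff [IsProbabilityMeasure P] (h : IsRandomCoeff P D κ α κmax)
    (u v : Pair d D) : energy (meanCoeff P κ) u v = ∫ ω, energy (κ ω) u v ∂P := by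
  rw [h.isBddCoeff_meanCoeff.energy_eq_sum, integral_congr_ae (h.ae_energy_eq_sum u v),
    integral_finsetSum _ fun i _ => integrable_finsetSum _ fun j _ =>
      (h.integrable_prod_entry u v i j).integral_prod_left]
  refine Finset.sum_congr rfl fun i _ => ?_
  rw [integral_finsetSum _ fun j _ => (h.integrable_prod_entry u v i j).integral_prod_left]
  refine Finset.sum_congr rfl fun j _ => ?_
  rw [integral_integral_swap (h.integrable_prod_entry u v i j)]
  simp only [meanCoeff, Matrix.of_apply, integral_mul_const]

theorem ae_energy_comm (h : IsRandomCoeff P D κ α κmax) :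
    ∀ᵐ ω ∂P, ∀ u v : Pair d D, energy (κ ω) u v = energy (κ ω) v u := by
  filter_upwards [h.ae_posSemidef] with ω hω
  exact energy_comm (hω.mono fun x hx => hx.1)

theorem ae_le_energy (h : IsRandomCoeff P D κ α κmax) :
    ∀ᵐ ω ∂P, ∀ u : Pair d D, α * ‖u.snd‖ ^ 2 ≤ energy (κ ω) u u := by
  filter_upwards [h.lower, h.ae_isBddCoeff] with ω h1 h2 u
  rw [← energy_const]
  exact (isBddCoeff_const α).energy_le_energy h2 h1 u

theorem ae_energy_le (h : IsRandomCoeff P D κ α κmax) :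
    ∀ᵐ ω ∂P, ∀ u : Pair d D, energy (κ ω) u u ≤ κmax * ‖u.snd‖ ^ 2 := by
  filter_upwards [h.upper, h.ae_isBddCoeff] with ω h1 h2 u
  rw [← energy_const]
  exact h2.energy_le_energy (isBddCoeff_const κmax) h1 u

theorem ae_energy_nonneg (h : IsRandomCoeff P D κ α κmax) :
    ∀ᵐ ω ∂P, ∀ u : Pair d D, 0 ≤ energy (κ ω) u u := by
  filter_upwards [h.ae_le_energy] with ω hω u
  exact (mul_nonneg h.pos.le (sq_nonneg _)).trans (hω u)

variable [IsProbabilityMeasure P]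

theorem energy_meanCoeff_comm (h : IsRandomCoeff P D κ α κmax) (u v : Pair d D) :
    energy (meanCoeff P κ) u v = energy (meanCoeff P κ) v u := by
  rw [h.energy_meanCoeff, h.energy_meanCoeff]
  refine integral_congr_ae ?_
  filter_upwards [h.ae_energy_comm] with ω hω using hω u v

theorem le_energy_meanCoeff (h : IsRandomCoeff P D κ α κmax) (u : Pair d D) :
    α * ‖u.snd‖ ^ 2 ≤ energy (meanCoeff P κ) u u := by
  rw [h.energy_meanCoeff]
  have := integral_mono_ae (integrable_const (α * ‖u.snd‖ ^ 2)) (h.integrable_energy u u)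
    (h.ae_le_energy.mono fun ω hω => hω u)
  simpa using this

theorem energy_meanCoeff_le (h : IsRandomCoeff P D κ α κmax) (u : Pair d D) :
    energy (meanCoeff P κ) u u ≤ κmax * ‖u.snd‖ ^ 2 := by
  rw [h.energy_meanCoeff]
  have := integral_mono_ae (h.integrable_energy u u) (integrable_const (κmax * ‖u.snd‖ ^ 2))
    (h.ae_energy_le.mono fun ω hω => hω u)
  simpa using this

theorem ae_energy_le_meanCoeff (h : IsRandomCoeff P D κ α κmax) {C : ℝ}
    (hC : ∀ᵐ ω ∂P, ∀ᵐ x ∂(volume.restrict D), (C • meanCoeff P κ x - κ ω x).PosSemidef) :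
    ∀ᵐ ω ∂P, ∀ u : Pair d D, energy (κ ω) u u ≤ C * energy (meanCoeff P κ) u u := by
  filter_upwards [hC, h.ae_isBddCoeff] with ω h1 h2 u
  rw [← energy_const_smul]
  exact h2.energy_le_energy (h.isBddCoeff_meanCoeff.const_smul C) h1 u

/-- Averaging `⟨u, u⟩_κ ≤ C ⟨u, u⟩_κ̄` over `ω` gives `1 ≤ C`. -/
theorem one_le_of_ae_le_meanCoeff (h : IsRandomCoeff P D κ α κmax) {C : ℝ}
    (hC : ∀ᵐ ω ∂P, ∀ᵐ x ∂(volume.restrict D), (C • meanCoeff P κ x - κ ω x).PosSemidef)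
    {u : Pair d D} (hu : energy (meanCoeff P κ) u u = 1) : 1 ≤ C := by
  have := integral_mono_ae (h.integrable_energy u u) (integrable_const C)
    ((h.ae_energy_le_meanCoeff hC).mono fun ω hω => by simpa [hu] using hω u)
  rw [← h.energy_meanCoeff, hu] at this
  simpa using this

end IsRandomCoeff

end Random

/-! ### Poincaré's inequality -/

section Poincare

variable {d : ℕ} {D : Set (Space d)}

/-- Integration by parts against the coordinate `x i`, whose derivative along `e_i` is `1`. -/
theorem integral_sq_eq_neg_integral_apply_mul {θ : Space d → ℝ} (hθ : IsTest D θ) (i : Fin d) :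
    ∫ x, θ x ^ 2 = - ∫ x, 2 * θ x * inner ℝ (gradient θ x) (EuclideanSpace.single i 1) * x i := by
  obtain ⟨hs, hc, -⟩ := hθ
  set e : Space d := EuclideanSpace.single i 1
  have hd : Differentiable ℝ θ := hs.differentiable (by simp)
  have hcont : Continuous (fun x => fderiv ℝ θ x e) :=
    (hs.continuous_fderiv (by simp)).clm_apply continuous_const
  have hcoord : ∀ x, fderiv ℝ (fun x : Space d => x i) x = EuclideanSpace.proj i :=
    fun x => (EuclideanSpace.proj (𝕜 := ℝ) i : Space d →L[ℝ] ℝ).fderiv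
  have hfd : ∀ x, fderiv ℝ (fun x => θ x ^ 2) x e = 2 * θ x * fderiv ℝ θ x e := fun x => by
    rw [fderiv_fun_pow 2 (hd x)]
    simp
  have hgrad : ∀ x, inner ℝ (gradient θ x) e = fderiv ℝ θ x e := fun x => by
    simp [gradient]
  have hci : Continuous fun x : Space d => x i := PiLp.continuous_apply 2 _ i
  have hsupp : HasCompactSupport fun x => θ x ^ 2 := hc.comp_left (g := fun t => t ^ 2) (by simp)
  have hint : Integrable (fun x => θ x ^ 2) :=
    (hs.continuous.pow 2).integrable_of_hasCompactSupport hsupp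
  have key := integral_mul_fderiv_eq_neg_fderiv_mul_of_integrable (μ := volume) (v := e)
    (f := fun x => θ x ^ 2) (g := fun x : Space d => x i) ?_ ?_ ?_
    (fun x _ => (hd x).pow 2) (fun x _ => (EuclideanSpace.proj (𝕜 := ℝ) i).differentiableAt)
  · simp only [hcoord, hfd] at key
    simpa [hgrad, e] using key
  · simp only [hfd]
    refine (((continuous_const.mul hs.continuous).mul hcont).mul
      hci).integrable_of_hasCompactSupport ?_
    exact ((hc.mul_left (f := fun _ => (2 : ℝ))).mul_right).mul_right
  · simpa [hcoord, e] using hint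
  · exact ((hs.continuous.pow 2).mul hci).integrable_of_hasCompactSupport hsupp.mul_right

theorem norm_fst_le_of_test {R : ℝ} (hR : 0 ≤ R) (hD : D ⊆ Metric.closedBall 0 R) (i : Fin d)
    {w : Pair d D} {θ : Space d → ℝ} (hθ : IsTest D θ) (hv : val w =ᵐ[volume.restrict D] θ)
    (hg : grad w =ᵐ[volume.restrict D] gradient θ) :
    ‖w.fst‖ ≤ 2 * R * ‖w.snd‖ := by
  have hzero : ∀ x, x ∉ D → θ x = 0 := fun x hx =>
    image_eq_zero_of_notMem_tsupport fun h => hx (hθ.2.2 h)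
  have hfst : ‖w.fst‖ ^ 2 = ∫ x in D, θ x ^ 2 := by
    rw [← real_inner_self_eq_norm_sq, L2.inner_def]
    refine integral_congr_ae ?_
    filter_upwards [hv] with x hx
    rw [← hx, real_inner_self_eq_norm_sq, Real.norm_eq_abs, sq_abs]
    rfl
  have hsnd : ‖w.snd‖ ^ 2 = ∫ x in D, ‖gradient θ x‖ ^ 2 := by
    rw [← real_inner_self_eq_norm_sq, L2.inner_def]
    refine integral_congr_ae ?_
    filter_upwards [hg] with x hx
    rw [← hx, real_inner_self_eq_norm_sq]
    rfl
  have hint1 : Integrable (fun x => θ x ^ 2) (volume.restrict D) :=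
    ((Lp.memLp w.fst).integrable_sq).congr (by filter_upwards [hv] with x hx; rw [← hx]; rfl)
  have hint2 : Integrable (fun x => ‖gradient θ x‖ ^ 2) (volume.restrict D) :=
    ((Lp.memLp w.snd).norm.integrable_sq).congr
      (by filter_upwards [hg] with x hx; rw [← hx]; rfl)
  have hle : ∫ x in D, θ x ^ 2 ≤
      ∫ x in D, (2⁻¹ * θ x ^ 2 + 2 * R ^ 2 * ‖gradient θ x‖ ^ 2) := by
    rw [setIntegral_eq_integral_of_forall_compl_eq_zero fun x hx => by simp [hzero x hx],
      integral_sq_eq_neg_integral_apply_mul hθ i, ← integral_neg,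
      ← setIntegral_eq_integral_of_forall_compl_eq_zero (s := D)
        fun x hx => by simp [hzero x hx]]
    -- If the left integrand is not integrable its integral is `0` by convention and the bound is
    -- trivial, so integrability need not be proved.
    by_cases hI : Integrable (fun x => -(2 * θ x * inner ℝ (gradient θ x)
        (EuclideanSpace.single i 1) * x i)) (volume.restrict D)
    · refine integral_mono hI ((hint1.const_mul _).add (hint2.const_mul _)) fun x => ?_
      by_cases hx : x ∈ D
      · set g : ℝ := inner ℝ (gradient θ x) (EuclideanSpace.single i 1)
        have hg : |g| ≤ ‖gradient θ x‖ := by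
          refine (abs_real_inner_le_norm _ _).trans ?_
          simp
        have hxi : |x i| ≤ R :=
          (PiLp.norm_apply_le x i).trans (mem_closedBall_zero_iff.1 (hD hx))
        have hgx : (g * x i) ^ 2 ≤ R ^ 2 * ‖gradient θ x‖ ^ 2 := by
          rw [mul_pow, mul_comm, ← sq_abs (x i), ← sq_abs g]
          gcongr
        -- Young's inequality with weights `1/2` and `2`: the term `θ² / 2` is absorbed on the left,
        -- which yields the constant `2 * R`.
        nlinarith [sq_nonneg (θ x + 2 * (g * x i))]
      · simp only [hzero x hx]
        norm_num
        positivity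
    · rw [integral_undef hI]
      positivity
  rw [integral_add (hint1.const_mul _) (hint2.const_mul _), integral_const_mul,
    integral_const_mul, ← hfst, ← hsnd] at hle
  refine (sq_le_sq₀ (norm_nonneg _) (by positivity)).1 ?_
  nlinarith

/-- **Poincaré's inequality** on `H¹₀(D)` for bounded `D`. -/
theorem norm_fst_le_of_mem_H10 {R : ℝ} (hR : 0 ≤ R) (hD : D ⊆ Metric.closedBall 0 R) (i : Fin d)
    {u : Pair d D} (hu : u ∈ H10 D) : ‖u.fst‖ ≤ 2 * R * ‖u.snd‖ := by
  have hcl : IsClosed {u : Pair d D | ‖u.fst‖ ≤ 2 * R * ‖u.snd‖} :=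
    isClosed_le (by fun_prop) (by fun_prop)
  refine closure_minimal (fun w hw => ?_) hcl hu
  -- Test pairs already form a subspace, so passing to the span adds nothing.
  suffices h : ∃ θ : Space d → ℝ, IsTest D θ ∧ val w =ᵐ[volume.restrict D] θ ∧
      grad w =ᵐ[volume.restrict D] gradient θ by
    obtain ⟨θ, h1, h2, h3⟩ := h
    exact norm_fst_le_of_test hR hD i h1 h2 h3
  refine Submodule.span_induction (fun _ h => h) ?_ ?_ ?_ hw
  · refine ⟨fun _ => 0, ⟨contDiff_const, HasCompactSupport.zero, by simp [tsupport]⟩, ?_, ?_⟩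
    · exact Lp.coeFn_zero _ _ _
    · have : gradient (fun _ : Space d => (0 : ℝ)) = 0 := by ext1 x; simp
      rw [this]
      exact Lp.coeFn_zero _ _ _
  · rintro u v - - ⟨θ, ⟨h1, h2, h3⟩, hu, hu'⟩ ⟨η, ⟨k1, k2, k3⟩, hv, hv'⟩
    refine ⟨fun x => θ x + η x, ⟨h1.add k1, h2.add k2,
      (tsupport_add θ η).trans (Set.union_subset h3 k3)⟩, ?_, ?_⟩
    · filter_upwards [hu, hv, Lp.coeFn_add u.fst v.fst] with x a b c
      rw [← a, ← b]
      exact c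
    · filter_upwards [hu', hv', grad_add u v] with x a b c
      rw [c, a, b, gradient, gradient, gradient, fderiv_fun_add (h1.differentiable (by simp) x)
        (k1.differentiable (by simp) x), map_add]
  · rintro c u - ⟨θ, ⟨h1, h2, h3⟩, hu, hu'⟩
    refine ⟨fun x => c * θ x, ⟨contDiff_const.mul h1, h2.mul_left,
      (tsupport_mul_subset_right).trans h3⟩, ?_, ?_⟩
    · filter_upwards [hu, Lp.coeFn_smul c u.fst] with x a b
      rw [← a]
      exact b
    · filter_upwards [hu', grad_smul c u] with x a b
      rw [b, a, gradient, gradient, fderiv_const_mul (h1.differentiable (by simp) x), map_smul]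

end Poincare

/-! ### Orthonormal expansion for a coercive bilinear form -/

section Expansion

open Filter Topology

variable {H : Type*} [NormedAddCommGroup H] [InnerProductSpace ℝ H]
  {B : H →L[ℝ] H →L[ℝ] ℝ} {ζ : ℕ → H}

/-- The remainder `u - ∑_{q < N} B(u, ζ_q) ζ_q` of the expansion of `u` along `ζ`. -/
def remainder (B : H →L[ℝ] H →L[ℝ] ℝ) (ζ : ℕ → H) (N : ℕ) : H →L[ℝ] H :=
  ContinuousLinearMap.id ℝ H - ∑ q ∈ Finset.range N, (B.flip (ζ q)).smulRight (ζ q)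

theorem remainder_apply (N : ℕ) (u : H) :
    remainder B ζ N u = u - ∑ q ∈ Finset.range N, B u (ζ q) • ζ q := by
  simp [remainder]

theorem remainder_succ (N : ℕ) (u : H) :
    remainder B ζ (N + 1) u = remainder B ζ N u - B u (ζ N) • ζ N := by
  rw [remainder_apply, remainder_apply, Finset.sum_range_succ, sub_add_eq_sub_sub]

variable (hB : ∀ u v, B u v = B v u) (hpos : ∀ u, 0 ≤ B u u)
  (hζ : ∀ q r, B (ζ q) (ζ r) = if q = r then 1 else 0)

include hζ in
theorem apply_remainder_of_le {N q : ℕ} (h : N ≤ q) (u : H) :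
    B (remainder B ζ N u) (ζ q) = B u (ζ q) := by
  have : ∀ r ∈ Finset.range N, B u (ζ r) * B (ζ r) (ζ q) = 0 := fun r hr => by
    rw [hζ, if_neg (by have := Finset.mem_range.1 hr; omega), mul_zero]
  simp [remainder_apply, Finset.sum_eq_zero this]

include hζ in
theorem remainder_apply_self_of_lt {N q : ℕ} (h : q < N) : remainder B ζ N (ζ q) = 0 := by
  rw [remainder_apply, Finset.sum_eq_single_of_mem q (Finset.mem_range.2 h), hζ, if_pos rfl,
    one_smul, sub_self]
  intro r _ hr
  rw [hζ, if_neg hr.symm, zero_smul]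

include hB hζ in
theorem remainder_form_succ (N : ℕ) (u : H) :
    B (remainder B ζ N u) (remainder B ζ N u) =
      B u (ζ N) ^ 2 + B (remainder B ζ (N + 1) u) (remainder B ζ (N + 1) u) := by
  have h1 := apply_remainder_of_le hζ le_rfl u (N := N)
  have h2 := hB (ζ N) (remainder B ζ N u)
  simp only [remainder_succ, map_sub, map_smul, sub_apply,
    smul_apply, h2, h1, hζ, smul_eq_mul, if_true]
  ring

-- Pythagoras for one mode at a time, telescoped.
include hB hζ in
theorem remainder_form_eq_sum_add (N n : ℕ) (u : H) :
    B (remainder B ζ N u) (remainder B ζ N u) =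
      ∑ k ∈ Finset.range n, B u (ζ (N + k)) ^ 2 +
        B (remainder B ζ (N + n) u) (remainder B ζ (N + n) u) := by
  induction n with
  | zero => simp
  | succ n ih => rw [ih, remainder_form_succ hB hζ (N + n), Finset.sum_range_succ]; ring_nf

include hB hζ in
theorem remainder_form_le (N : ℕ) (u : H) :
    B (remainder B ζ N u) (remainder B ζ N u) ≤ B u u := by
  have := remainder_form_eq_sum_add hB hζ 0 N u
  rw [Nat.zero_add, remainder_apply 0, Finset.sum_range_zero, sub_zero] at this
  rw [this]
  exact le_add_of_nonneg_left (Finset.sum_nonneg fun _ _ => sq_nonneg _)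

include hζ in
theorem exists_remainder_eq_zero {w : H} (hw : w ∈ Submodule.span ℝ (Set.range ζ)) :
    ∃ N, ∀ n, N ≤ n → remainder B ζ n w = 0 := by
  induction hw using Submodule.span_induction with
  | mem x hx =>
    obtain ⟨q, rfl⟩ := hx
    exact ⟨q + 1, fun n hn => remainder_apply_self_of_lt hζ hn⟩
  | zero => exact ⟨0, fun n _ => map_zero _⟩
  | add x y _ _ hx hy =>
    obtain ⟨N, hN⟩ := hx
    obtain ⟨N', hN'⟩ := hy
    refine ⟨max N N', fun n hn => ?_⟩
    rw [map_add, hN n (le_of_max_le_left hn), hN' n (le_of_max_le_right hn), add_zero]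
  | smul c x _ hx =>
    obtain ⟨N, hN⟩ := hx
    exact ⟨N, fun n hn => by rw [map_smul, hN n hn, smul_zero]⟩

-- Remainders of finite combinations eventually vanish, and taking remainders does not increase `B`;
-- density does the rest.
include hB hpos hζ in
theorem tendsto_remainder_form {u : H}
    (hu : u ∈ (Submodule.span ℝ (Set.range ζ)).topologicalClosure) :
    Tendsto (fun n => B (remainder B ζ n u) (remainder B ζ n u)) atTop (𝓝 0) := by
  rw [Metric.tendsto_atTop]
  intro ε hε
  have hcont : ContinuousAt (fun w => B (u - w) (u - w)) u := by fun_prop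
  have hnhds : ∀ᶠ w in 𝓝 u, B (u - w) (u - w) < ε := by
    apply hcont.eventually_lt_const
    simpa using hε
  obtain ⟨w, hw, hwspan⟩ := mem_closure_iff_nhds.1 hu _ hnhds
  obtain ⟨N, hN⟩ := exists_remainder_eq_zero hζ hwspan
  refine ⟨N, fun n hn => ?_⟩
  have heq : remainder B ζ n u = remainder B ζ n (u - w) := by rw [map_sub, hN n hn, sub_zero]
  rw [Real.dist_0_eq_abs, abs_of_nonneg (hpos _), heq]
  exact (remainder_form_le hB hζ n _).trans_lt hw

-- Parseval for the tail. Stating it in `ENNReal` avoids any summability question.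
include hB hpos hζ in
theorem ofReal_remainder_form_le_tsum {u : H}
    (hu : u ∈ (Submodule.span ℝ (Set.range ζ)).topologicalClosure) (Q : ℕ) :
    ENNReal.ofReal (B (remainder B ζ Q u) (remainder B ζ Q u)) ≤
      ∑' k, ENNReal.ofReal (B u (ζ (Q + k)) ^ 2) := by
  have hlim : Tendsto (fun n => ∑' k, ENNReal.ofReal (B u (ζ (Q + k)) ^ 2) +
      ENNReal.ofReal (B (remainder B ζ (Q + n) u) (remainder B ζ (Q + n) u))) atTop
      (𝓝 (∑' k, ENNReal.ofReal (B u (ζ (Q + k)) ^ 2) + 0)) := by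
    refine tendsto_const_nhds.add ?_
    have := (tendsto_remainder_form hB hpos hζ hu).comp (tendsto_add_atTop_nat Q)
    simpa [add_comm Q] using ENNReal.tendsto_ofReal this
  rw [add_zero] at hlim
  refine ge_of_tendsto' hlim fun n => ?_
  rw [remainder_form_eq_sum_add hB hζ Q n, ENNReal.ofReal_add
    (Finset.sum_nonneg fun _ _ => sq_nonneg _) (hpos _),
    ENNReal.ofReal_sum_of_nonneg fun _ _ => sq_nonneg _]
  gcongr
  exact ENNReal.sum_le_tsum _

variable [CompleteSpace H] [SecondCountableTopology H] {Ω : Type*} [MeasurableSpace Ω]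
  {P : Measure Ω} {ψ : Ω → H}

include hB in
/-- If the covariance of `ψ` vanishes on the `B`-orthogonal complement of `ζ`, then `ψ` almost
surely lies in the closed span of `ζ`. -/
theorem ae_mem_closure_span (hco : IsCoercive B)
    (hψ : ∀ v, (∀ q, B (ζ q) v = 0) → ∀ᵐ ω ∂P, B (ψ ω) v = 0) :
    ∀ᵐ ω ∂P, ψ ω ∈ (Submodule.span ℝ (Set.range ζ)).topologicalClosure := by
  set K := (Submodule.span ℝ (Set.range ζ)).topologicalClosure with hK
  have : CompleteSpace K := (Submodule.isClosed_topologicalClosure _).completeSpace_coe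
  have hζK : ∀ q, ζ q ∈ K := fun q =>
    Submodule.le_topologicalClosure _ (Submodule.subset_span ⟨q, rfl⟩)
  have hzero : (fun ω => Kᗮ.starProjection (ψ ω)) =ᵐ[P] 0 := by
    -- The exceptional null set depends on the test vector `c`; separability reduces to countably
    -- many.
    refine ae_eq_zero_of_forall_inner (𝕜 := ℝ) fun c => ?_
    -- The Hilbert inner product is not `B`, so Lax-Milgram converts the projection of `c` onto `Kᗮ`
    -- into a vector `w` that is `B`-orthogonal to all modes.
    set w := hco.continuousLinearEquivOfBilin.symm (Kᗮ.starProjection c)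
    have hw : ∀ v, inner ℝ (Kᗮ.starProjection c) v = B w v := fun v => by
      rw [← hco.continuousLinearEquivOfBilin_apply, ContinuousLinearEquiv.apply_symm_apply]
    have hwζ : ∀ q, B (ζ q) w = 0 := fun q => by
      rw [hB, ← hw]
      exact Submodule.inner_left_of_mem_orthogonal (hζK q) (Submodule.starProjection_apply_mem _ c)
    filter_upwards [hψ w hwζ] with ω hω
    rw [← Submodule.inner_starProjection_left_eq_right, hw, hB, hω, Pi.zero_apply]
  filter_upwards [hzero] with ω hω
  have : ψ ω ∈ Kᗮᗮ := (Submodule.starProjection_apply_eq_zero_iff _).1 hω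
  rwa [Submodule.orthogonal_orthogonal] at this

include hB hpos hζ in
theorem ae_ofReal_remainder_form_le_tsum (hco : IsCoercive B)
    (hψ : ∀ v, (∀ q, B (ζ q) v = 0) → ∀ᵐ ω ∂P, B (ψ ω) v = 0) :
    ∀ᵐ ω ∂P, ∀ Q, ENNReal.ofReal (B (remainder B ζ Q (ψ ω)) (remainder B ζ Q (ψ ω))) ≤
      ∑' k, ENNReal.ofReal (B (ψ ω) (ζ (Q + k)) ^ 2) := by
  filter_upwards [ae_mem_closure_span hB hco hψ] with ω hω Q
  exact ofReal_remainder_form_le_tsum hB hpos hζ hω Q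

end Expansion

/-! ### Weak solutions and Galerkin approximation -/

section CellProblem

variable {d : ℕ} {D : Set (Space d)} {A : Coeff d} {M : ℝ}

theorem norm_snd_le (u : Pair d D) : ‖u.snd‖ ≤ ‖u‖ := by
  have := WithLp.prod_norm_sq_eq_of_L2 u
  exact (sq_le_sq₀ (norm_nonneg _) (norm_nonneg _)).1 (by nlinarith [sq_nonneg ‖u.fst‖])

theorem norm_le_of_mem_H10 {R : ℝ} (hR : 0 ≤ R) (hD : D ⊆ Metric.closedBall 0 R) (i : Fin d)
    {u : Pair d D} (hu : u ∈ H10 D) : ‖u‖ ≤ (2 * R + 1) * ‖u.snd‖ := by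
  have h1 := norm_fst_le_of_mem_H10 hR hD i hu
  have h2 := WithLp.prod_norm_sq_eq_of_L2 u
  have h3 : ‖u‖ ≤ ‖u.fst‖ + ‖u.snd‖ :=
    (sq_le_sq₀ (norm_nonneg _) (by positivity)).1
      (by nlinarith [mul_nonneg (norm_nonneg u.fst) (norm_nonneg u.snd)])
  linarith

theorem IsBddCoeff.energy_sub_left (hA : IsBddCoeff D A M) (u u' v : Pair d D) :
    energy A (u - u') v = energy A u v - energy A u' v :=
  LinearMap.map_sub₂ hA.form u u' v

theorem IsBddCoeff.energy_sub_right (hA : IsBddCoeff D A M) (u v v' : Pair d D) :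
    energy A u (v - v') = energy A u v - energy A u v' :=
  map_sub (hA.form u) v v'

theorem IsBddCoeff.sq_energy_le (hA : IsBddCoeff D A M)
    (hsymm : ∀ u v : Pair d D, energy A u v = energy A v u)
    (hpos : ∀ u : Pair d D, 0 ≤ energy A u u) (u v : Pair d D) :
    energy A u v ^ 2 ≤ energy A u u * energy A v v :=
  hA.form.apply_sq_le_of_symm hpos ⟨hsymm⟩ u v

theorem IsBddCoeff.abs_energy_le (hA : IsBddCoeff D A M)
    (hsymm : ∀ u v : Pair d D, energy A u v = energy A v u)
    (hpos : ∀ u : Pair d D, 0 ≤ energy A u u) (u v : Pair d D) :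
    |energy A u v| ≤ energyNorm A u * energyNorm A v := by
  rw [energyNorm, energyNorm, ← Real.sqrt_mul (hpos u)]
  exact Real.abs_le_sqrt (hA.sq_energy_le hsymm hpos u v)

/-- The weak solution minimizes the energy among the functions with its boundary values. -/
theorem IsCellSolution.energy_le (hA : IsBddCoeff D A M)
    (hsymm : ∀ u v : Pair d D, energy A u v = energy A v u)
    (hpos : ∀ u : Pair d D, 0 ≤ energy A u u) {g u : Pair d D} (h : IsCellSolution A g u) :
    energy A u u ≤ energy A g g := by
  -- Testing with `u - g` gives `⟨u, u⟩ = ⟨u, g⟩`, hence `0 ≤ ⟨u - g, u - g⟩ = ⟨g, g⟩ - ⟨u, u⟩`.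
  have h1 := h.weak _ h.boundary
  have h2 := hpos (u - g)
  rw [hA.energy_sub_right] at h1
  rw [hA.energy_sub_left, hA.energy_sub_right, hA.energy_sub_right, hsymm g u] at h2
  linarith

section Galerkin

variable {g u φbar : Pair d D} {ζ : ℕ → Pair d D} {Q : ℕ} {c : Fin Q → ℝ}

theorem IsCellSolution.sub_reducedBasisFun_mem (h : IsCellSolution A g u)
    (hζ : ∀ q, ζ q ∈ H10 D) (hbar : φbar - g ∈ H10 D) (c : Fin Q → ℝ) :
    u - reducedBasisFun ζ φbar c ∈ H10 D := by
  have := sub_mem (sub_mem h.boundary hbar)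
    (Submodule.sum_mem _ fun q _ => Submodule.smul_mem _ (c q) (hζ q) :
      ∑ q : Fin Q, c q • ζ q ∈ H10 D)
  convert this using 1
  rw [reducedBasisFun]
  abel

theorem IsBddCoeff.energy_sum_smul_right (hA : IsBddCoeff D A M) (v : Pair d D)
    (b : Fin Q → ℝ) :
    energy A v (∑ q : Fin Q, b q • ζ q) = ∑ q : Fin Q, b q * energy A v (ζ q) :=
  (map_sum (hA.form v) _ _).trans (by simp only [hA.form_apply, energy_smul_right])

/-- Galerkin orthogonality. -/
theorem IsCellSolution.energy_sub_reducedBasisFun (hA : IsBddCoeff D A M)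
    (hsymm : ∀ u v : Pair d D, energy A u v = energy A v u)
    (h : IsCellSolution A g u) (hζ : ∀ q, ζ q ∈ H10 D)
    (hc : (galerkinMatrix A ζ Q).mulVec c = galerkinLoad A ζ φbar Q) (q : Fin Q) :
    energy A (u - reducedBasisFun ζ φbar c) (ζ q) = 0 := by
  have h1 := congrFun hc q
  simp only [galerkinMatrix, galerkinLoad, Matrix.mulVec, dotProduct, Matrix.of_apply] at h1
  rw [hA.energy_sub_left, h.weak _ (hζ q), reducedBasisFun, hA.energy_add_left,
    hsymm _ (ζ q), hsymm (∑ q : Fin Q, c q • ζ q), hA.energy_sum_smul_right]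
  simp only [mul_comm] at h1 ⊢
  rw [h1, hsymm (ζ q)]
  ring

/-- The Galerkin solution is the best approximation in the energy norm. -/
theorem IsCellSolution.energy_sub_reducedBasisFun_le (hA : IsBddCoeff D A M)
    (hsymm : ∀ u v : Pair d D, energy A u v = energy A v u)
    (hpos : ∀ u : Pair d D, 0 ≤ energy A u u)
    (h : IsCellSolution A g u) (hζ : ∀ q, ζ q ∈ H10 D)
    (hc : (galerkinMatrix A ζ Q).mulVec c = galerkinLoad A ζ φbar Q) (b : Fin Q → ℝ) :
    energy A (u - reducedBasisFun ζ φbar c) (u - reducedBasisFun ζ φbar c) ≤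
      energy A (u - reducedBasisFun ζ φbar b) (u - reducedBasisFun ζ φbar b) := by
  set e := u - reducedBasisFun ζ φbar c with he
  have hw : u - reducedBasisFun ζ φbar b = e + ∑ q : Fin Q, (c q - b q) • ζ q := by
    simp only [he, reducedBasisFun, sub_smul, Finset.sum_sub_distrib]
    abel
  have horth : energy A e (∑ q : Fin Q, (c q - b q) • ζ q) = 0 := by
    rw [hA.energy_sum_smul_right]
    exact Finset.sum_eq_zero fun q _ => by
      rw [h.energy_sub_reducedBasisFun hA hsymm hζ hc q, mul_zero]
  rw [hw, hA.energy_add_left, hA.energy_add_right, hA.energy_add_right,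
    hsymm (∑ q : Fin Q, (c q - b q) • ζ q) e, horth]
  linarith [hpos (∑ q : Fin Q, (c q - b q) • ζ q)]

/-- The error of the energies of two solutions is the energy of the errors. -/
theorem energy_sub_energy_eq (hA : IsBddCoeff D A M)
    (hsymm : ∀ u v : Pair d D, energy A u v = energy A v u) {g' u' w w' : Pair d D}
    (h : IsCellSolution A g u) (h' : IsCellSolution A g' u') (hw : u - w ∈ H10 D)
    (hw' : u' - w' ∈ H10 D) :
    energy A u u' - energy A w w' = - energy A (u - w) (u' - w') := by
  -- Each solution is tested against the error of the other; only the boundary values of `w` and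
  -- `w'` matter.
  have h1 := h.weak _ hw'
  have h2 := h'.weak _ hw
  rw [hA.energy_sub_right] at h1 h2
  rw [hA.energy_sub_left, hA.energy_sub_right, hA.energy_sub_right]
  linarith [hsymm u' u, hsymm u' w]

end Galerkin

end CellProblem

/-! ### Bounds and means of the random solutions -/

section RandomCell

variable {d : ℕ} {D : Set (Space d)} {Ω : Type*} [MeasurableSpace Ω] {P : Measure Ω}
  {κ : Ω → Coeff d} {α κmax : ℝ} {g : Pair d D} {φ : Ω → Pair d D}

theorem IsRandomCoeff.ae_energy_le_of_isCellSolution (h : IsRandomCoeff P D κ α κmax)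
    (hφ : ∀ᵐ ω ∂P, IsCellSolution (κ ω) g (φ ω)) :
    ∀ᵐ ω ∂P, energy (κ ω) (φ ω) (φ ω) ≤ κmax * ‖g.snd‖ ^ 2 := by
  filter_upwards [hφ, h.ae_isBddCoeff, h.ae_energy_comm, h.ae_energy_nonneg, h.ae_energy_le]
    with ω h1 h2 h3 h4 h5
  exact (h1.energy_le h2 h3 h4).trans (h5 g)

/-- Ellipticity controls the gradient and Poincaré, applied to `φ - g`, the function. The
deterministic bound makes `φ` and the products of its coefficients integrable. -/
theorem IsRandomCoeff.exists_ae_norm_le (h : IsRandomCoeff P D κ α κmax) {R : ℝ} (hR : 0 ≤ R)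
    (hD : D ⊆ Metric.closedBall 0 R) (i : Fin d)
    (hφ : ∀ᵐ ω ∂P, IsCellSolution (κ ω) g (φ ω)) : ∃ K, ∀ᵐ ω ∂P, ‖φ ω‖ ≤ K := by
  refine ⟨‖g‖ + (2 * R + 1) * (√(κmax * ‖g.snd‖ ^ 2 / α) + ‖g.snd‖), ?_⟩
  filter_upwards [hφ, h.ae_energy_le_of_isCellSolution hφ, h.ae_le_energy] with ω h1 h2 h3
  have hs : ‖(φ ω).snd‖ ≤ √(κmax * ‖g.snd‖ ^ 2 / α) := by
    refine Real.le_sqrt_of_sq_le ((le_div_iff₀ h.pos).2 ?_)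
    linarith [h3 (φ ω)]
  have hd : ‖(φ ω - g).snd‖ ≤ ‖(φ ω).snd‖ + ‖g.snd‖ := norm_sub_le _ _
  calc ‖φ ω‖ = ‖g + (φ ω - g)‖ := by rw [add_sub_cancel]
    _ ≤ ‖g‖ + ‖φ ω - g‖ := norm_add_le _ _
    _ ≤ _ := by
      gcongr
      refine (norm_le_of_mem_H10 hR hD i h1.boundary).trans ?_
      gcongr
      linarith

/-- A closed subspace contains the mean of a random element of it. -/
theorem meanField_sub_mem_H10 [IsProbabilityMeasure P] (hint : Integrable φ P)
    (hφ : ∀ᵐ ω ∂P, IsCellSolution (κ ω) g (φ ω)) : meanField P φ - g ∈ H10 D := by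
  have hm : meanField P φ - g = ∫ ω, (φ ω - g) ∂P := by
    rw [integral_sub hint (integrable_const g), integral_const]
    simp [meanField]
  rw [hm]
  exact (H10 D).convex.integral_mem (Submodule.isClosed_topologicalClosure _)
    (hφ.mono fun ω hω => hω.boundary) (hint.sub (integrable_const g))

namespace IsRandomCoeff

variable [IsProbabilityMeasure P]

theorem energy_meanCoeff_nonneg (h : IsRandomCoeff P D κ α κmax) (u : Pair d D) :
    0 ≤ energy (meanCoeff P κ) u u :=
  (mul_nonneg h.pos.le (sq_nonneg _)).trans (h.le_energy_meanCoeff u)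

theorem abs_energy_meanCoeff_le (h : IsRandomCoeff P D κ α κmax) (u v : Pair d D) :
    |energy (meanCoeff P κ) u v| ≤ |κmax| * ‖u‖ * ‖v‖ := by
  have hle : ∀ u : Pair d D, energy (meanCoeff P κ) u u ≤ |κmax| * ‖u‖ ^ 2 := fun u =>
    (h.energy_meanCoeff_le u).trans (by
      gcongr
      · exact le_abs_self _
      · exact norm_snd_le u)
  refine abs_le_of_sq_le_sq ?_ (by positivity)
  calc _ ≤ _ := h.isBddCoeff_meanCoeff.sq_energy_le h.energy_meanCoeff_comm
        h.energy_meanCoeff_nonneg u v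
    _ ≤ (|κmax| * ‖u‖ ^ 2) * (|κmax| * ‖v‖ ^ 2) :=
      mul_le_mul (hle u) (hle v) (h.energy_meanCoeff_nonneg v) (by positivity)
    _ = _ := by ring

/-- The energy of the mean coefficient as a continuous bilinear form. -/
def meanForm (h : IsRandomCoeff P D κ α κmax) : Pair d D →L[ℝ] Pair d D →L[ℝ] ℝ :=
  h.isBddCoeff_meanCoeff.form.mkContinuous₂ |κmax| h.abs_energy_meanCoeff_le

/-- The energy of the mean coefficient as a continuous bilinear form on `H¹₀(D)`. -/
def meanFormH10 (h : IsRandomCoeff P D κ α κmax) : H10 D →L[ℝ] H10 D →L[ℝ] ℝ :=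
  h.meanForm.bilinearComp (H10 D).subtypeL (H10 D).subtypeL

theorem meanFormH10_apply (h : IsRandomCoeff P D κ α κmax) (u v : H10 D) :
    h.meanFormH10 u v = energy (meanCoeff P κ) (u : Pair d D) v := rfl

theorem isCoercive_meanFormH10 (h : IsRandomCoeff P D κ α κmax) {R : ℝ} (hR : 0 ≤ R)
    (hD : D ⊆ Metric.closedBall 0 R) (i : Fin d) : IsCoercive h.meanFormH10 := by
  have hα := h.pos
  refine ⟨α / (2 * R + 1) ^ 2, by positivity, fun u => ?_⟩
  rw [meanFormH10_apply]
  refine le_trans ?_ (h.le_energy_meanCoeff _)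
  have h1 : ‖u‖ ≤ (2 * R + 1) * ‖(u : Pair d D).snd‖ := norm_le_of_mem_H10 hR hD i u.2
  rw [mul_assoc, ← sq, div_mul_eq_mul_div, div_le_iff₀ (by positivity), mul_assoc, ← mul_pow,
    mul_comm ‖_‖]
  gcongr

theorem aestronglyMeasurable_energy_meanCoeff (h : IsRandomCoeff P D κ α κmax)
    (hm : AEStronglyMeasurable φ P) (u : Pair d D) :
    AEStronglyMeasurable (fun ω => energy (meanCoeff P κ) (φ ω) u) P :=
  (h.meanForm.flip u).continuous.comp_aestronglyMeasurable hm

theorem integrable_energy_mul_energy (h : IsRandomCoeff P D κ α κmax)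
    (hm : AEStronglyMeasurable φ P) {K : ℝ} (hK : ∀ᵐ ω ∂P, ‖φ ω‖ ≤ K) (u v : Pair d D) :
    Integrable (fun ω => energy (meanCoeff P κ) (φ ω) u * energy (meanCoeff P κ) (φ ω) v) P := by
  refine Integrable.of_bound ((h.aestronglyMeasurable_energy_meanCoeff hm u).mul
    (h.aestronglyMeasurable_energy_meanCoeff hm v)) ((|κmax| * K * ‖u‖) * (|κmax| * K * ‖v‖)) ?_
  filter_upwards [hK] with ω hω
  have hK0 : 0 ≤ K := (norm_nonneg _).trans hω
  rw [norm_mul]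
  refine mul_le_mul ((h.abs_energy_meanCoeff_le _ _).trans ?_)
    ((h.abs_energy_meanCoeff_le _ _).trans ?_) (norm_nonneg _) (by positivity) <;> gcongr

end IsRandomCoeff

end RandomCell

/-- Modes are counted from zero, so the exponent is `-(q + 1)`; this shift makes the geometric tail
`β^(-Q) / (β - 1)`. -/
theorem tsum_ofReal_const_mul_zpow {C β : ℝ} (hC : 0 < C) (hβ : 1 < β) (Q : ℕ) :
    ∑' k : ℕ, ENNReal.ofReal (C * β ^ (-(((Q + k : ℕ) : ℤ) + 1))) =
      ENNReal.ofReal (C * β ^ (-(Q : ℤ)) / (β - 1)) := by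
  have hβ0 : 0 < β := one_pos.trans hβ
  have hgeom := (hasSum_geometric_of_lt_one (inv_pos.2 hβ0).le (inv_lt_one_of_one_lt₀ hβ)).mul_left
    (C * β ^ (-((Q : ℤ) + 1)))
  have hterm : ∀ k : ℕ, C * β ^ (-((Q : ℤ) + 1)) * β⁻¹ ^ k =
      C * β ^ (-(((Q + k : ℕ) : ℤ) + 1)) := fun k => by
    rw [mul_assoc, inv_pow, ← zpow_natCast, ← zpow_neg, ← zpow_add₀ hβ0.ne']
    congr 2
    push_cast
    ring
  simp only [hterm] at hgeom
  rw [← ENNReal.ofReal_tsum_of_nonneg (fun k => by positivity) hgeom.summable, hgeom.tsum_eq]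
  congr 1
  have h1 : β - 1 ≠ 0 := (sub_pos.2 hβ).ne'
  have h2 : 1 - β⁻¹ = (β - 1) / β := by field_simp
  rw [h2, neg_add, zpow_add₀ hβ0.ne', zpow_neg_one]
  field_simp

instance secondCountableTopology_pair {d : ℕ} {D : Set (Space d)} :
    SecondCountableTopology (Pair d D) :=
  have : Fact ((2 : ENNReal) ≠ ⊤) := ⟨by simp⟩
  have : SecondCountableTopology (Lp ℝ 2 (volume.restrict D)) := Lp.SecondCountableTopology
  have : SecondCountableTopology (Lp (Space d) 2 (volume.restrict D)) :=
    Lp.SecondCountableTopology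
  WithLp.secondCountableTopology 2 _ _

/-! ### The Karhunen-Loève tail -/

section KarhunenLoeve

variable {d : ℕ} {D : Set (Space d)} {Ω : Type*} [MeasurableSpace Ω] {P : Measure Ω}
  [IsProbabilityMeasure P] {κ : Ω → Coeff d} {α κmax : ℝ} {g : Pair d D} {φ : Ω → Pair d D}
  {lam : ℕ → ℝ} {ζ : ℕ → Pair d D}

/-- The square energies of the Karhunen-Loève coefficients of index at least `Q`, summed. -/
def klTail (P : Measure Ω) (A : Coeff d) (φ : Ω → Pair d D) (ζ : ℕ → Pair d D) (Q : ℕ) (ω : Ω) :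
    ENNReal :=
  ∑' k, ENNReal.ofReal (energy A (φ ω - meanField P φ) (ζ (Q + k)) ^ 2)

variable (h : IsRandomCoeff P D κ α κmax) (hm : AEStronglyMeasurable φ P)

include h hm

theorem aemeasurable_klTail (Q : ℕ) : AEMeasurable (klTail P (meanCoeff P κ) φ ζ Q) P :=
  AEMeasurable.tsum fun k => ENNReal.measurable_ofReal.comp_aemeasurable
    ((h.aestronglyMeasurable_energy_meanCoeff (hm.sub aestronglyMeasurable_const)
      (ζ (Q + k))).pow 2).aemeasurable

theorem lintegral_klTail {K : ℝ} (hK : ∀ᵐ ω ∂P, ‖φ ω - meanField P φ‖ ≤ K)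
    (hKL : IsKL P (meanCoeff P κ) φ lam ζ) (Q : ℕ) :
    ∫⁻ ω, klTail P (meanCoeff P κ) φ ζ Q ω ∂P = ∑' k, ENNReal.ofReal (lam (Q + k)) := by
  have hm' : AEStronglyMeasurable (fun ω => φ ω - meanField P φ) P :=
    hm.sub aestronglyMeasurable_const
  have hmeas : ∀ k, AEMeasurable (fun ω => ENNReal.ofReal
      (energy (meanCoeff P κ) (φ ω - meanField P φ) (ζ (Q + k)) ^ 2)) P := fun k =>
    ((h.aestronglyMeasurable_energy_meanCoeff hm' (ζ (Q + k))).pow 2).aemeasurable.ennreal_ofReal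
  unfold klTail
  rw [lintegral_tsum hmeas]
  congr 1 with k
  -- Testing the eigenvalue equation with the mode itself identifies the eigenvalue as the second
  -- moment of its coefficient.
  have hlam := hKL.eigen (Q + k) _ (hKL.mem (Q + k))
  rw [hKL.orthonormal, if_pos rfl, mul_one] at hlam
  simp only [covForm, ← sq] at hlam
  rw [← hlam, ofReal_integral_eq_lintegral_ofReal _ (.of_forall fun ω => sq_nonneg _)]
  simpa only [sq] using h.integrable_energy_mul_energy hm' hK (ζ (Q + k)) (ζ (Q + k))

omit hm in
theorem IsRandomCoeff.coe_remainder_meanFormH10 (hζ : ∀ q, ζ q ∈ H10 D) (Q : ℕ) (u : H10 D) :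
    ((remainder h.meanFormH10 (fun q => ⟨ζ q, hζ q⟩) Q u : H10 D) : Pair d D) =
      u - ∑ q : Fin Q, energy (meanCoeff P κ) (u : Pair d D) (ζ q) • ζ q := by
  have hsum := map_sum (H10 D).subtype (fun q : ℕ => h.meanFormH10 u ⟨ζ q, hζ q⟩ •
    (⟨ζ q, hζ q⟩ : H10 D)) (Finset.range Q)
  rw [remainder_apply]
  refine (map_sub (H10 D).subtype _ _).trans (congrArg _ (hsum.trans ?_))
  rw [Finset.sum_range]
  rfl

/-- The energy of the remainder of the Karhunen-Loève expansion is at most the tail. -/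
theorem ae_ofReal_energy_sub_le_klTail {K : ℝ} (hK : ∀ᵐ ω ∂P, ‖φ ω - meanField P φ‖ ≤ K)
    (hmem : ∀ᵐ ω ∂P, φ ω - meanField P φ ∈ H10 D) {R : ℝ} (hR : 0 ≤ R)
    (hD : D ⊆ Metric.closedBall 0 R) (i : Fin d)
    (hKL : IsKL P (meanCoeff P κ) φ lam ζ) :
    ∀ᵐ ω ∂P, ∀ Q, ∃ b : Fin Q → ℝ,
      ENNReal.ofReal (energy (meanCoeff P κ) (φ ω - reducedBasisFun ζ (meanField P φ) b)
        (φ ω - reducedBasisFun ζ (meanField P φ) b)) ≤ klTail P (meanCoeff P κ) φ ζ Q ω := by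
  have : CompleteSpace (H10 D) := (Submodule.isClosed_topologicalClosure _).completeSpace_coe
  have : SecondCountableTopology (H10 D) := TopologicalSpace.Subtype.secondCountableTopology _
  have hm' : AEStronglyMeasurable (fun ω => φ ω - meanField P φ) P :=
    hm.sub aestronglyMeasurable_const
  -- Projecting gives an `H10 D`-valued function for every `ω`; it is `φ - φ̄` almost surely.
  set ψ : Ω → H10 D := fun ω => (H10 D).orthogonalProjectionOnto (φ ω - meanField P φ)
  have hψ : ∀ᵐ ω ∂P, (ψ ω : Pair d D) = φ ω - meanField P φ := by
    filter_upwards [hmem] with ω hω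
    exact Submodule.starProjection_eq_self_iff.2 hω
  set ζ' : ℕ → H10 D := fun q => ⟨ζ q, hKL.mem q⟩
  have hmain := ae_ofReal_remainder_form_le_tsum (P := P) (B := h.meanFormH10) (ζ := ζ') (ψ := ψ)
    (fun u v => h.energy_meanCoeff_comm u v) (fun u => h.energy_meanCoeff_nonneg u)
    (fun q r => hKL.orthonormal q r) (h.isCoercive_meanFormH10 hR hD i) (fun v hv => ?_)
  · filter_upwards [hmain, hψ] with ω h1 h2 Q
    -- The witness is the vector of Karhunen-Loève coefficients.
    refine ⟨fun q => energy (meanCoeff P κ) (φ ω - meanField P φ) (ζ q), ?_⟩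
    have h3 := h1 Q
    simp only [IsRandomCoeff.meanFormH10_apply, h2] at h3
    rw [h.coe_remainder_meanFormH10 hKL.mem, h2] at h3
    rwa [reducedBasisFun, ← sub_sub]
  · have hint := h.integrable_energy_mul_energy hm' hK (v : Pair d D) v
    have hzero := hKL.exhaust v v.2 hv
    -- A square with zero expectation vanishes almost surely.
    rw [covForm, integral_eq_zero_iff_of_nonneg (fun ω => mul_self_nonneg _) hint] at hzero
    filter_upwards [hzero, hψ] with ω h1 h2
    rw [IsRandomCoeff.meanFormH10_apply, h2]
    exact mul_self_eq_zero.1 h1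

end KarhunenLoeve

/-! ### Probability estimates -/

section Main

variable {d : ℕ} {D : Set (Space d)} {Ω : Type*} [MeasurableSpace Ω] {P : Measure Ω}
  {κ : Ω → Coeff d} {α κmax : ℝ} {g : Pair d D} {φ : Ω → Pair d D}
  {lam : ℕ → ℝ} {ζ : ℕ → Pair d D}

/-- In dimension zero every energy vanishes, so no mode has norm one. This supplies the coordinate
that Poincaré's inequality needs. -/
theorem nonempty_fin_of_isKL {A : Coeff d} (hKL : IsKL P A φ lam ζ) : Nonempty (Fin d) := by
  by_contra hd
  rw [not_nonempty_iff] at hd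
  have := hKL.orthonormal 0 0
  simp [energy, dotProduct] at this

theorem IsRandomCoeff.integrable_of_isCellSolution [IsFiniteMeasure P] (h : IsRandomCoeff P D κ α κmax)
    (hDb : Bornology.IsBounded D) (i : Fin d) (hm : AEStronglyMeasurable φ P)
    (hφ : ∀ᵐ ω ∂P, IsCellSolution (κ ω) g (φ ω)) : Integrable φ P := by
  obtain ⟨R, hR, hD⟩ := hDb.subset_closedBall_lt 0 0
  obtain ⟨K, hK⟩ := h.exists_ae_norm_le hR.le hD i hφ
  exact .of_bound hm K hK

theorem ae_energyNorm_le (h : IsRandomCoeff P D κ α κmax)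
    (hφ : ∀ᵐ ω ∂P, IsCellSolution (κ ω) g (φ ω)) {C : ℝ} (hC : ‖g.snd‖ ≤ C) :
    ∀ᵐ ω ∂P, energyNorm (κ ω) (φ ω) ≤ C * √κmax := by
  filter_upwards [h.ae_energy_le_of_isCellSolution hφ] with ω hω
  calc energyNorm (κ ω) (φ ω) ≤ √(κmax * ‖g.snd‖ ^ 2) := Real.sqrt_le_sqrt hω
    _ = ‖g.snd‖ * √κmax := by
      rw [Real.sqrt_mul' _ (sq_nonneg _), Real.sqrt_sq (norm_nonneg _), mul_comm]
    _ ≤ _ := by gcongr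

/-- The reduced-basis error in the energy norm, in probability. -/
theorem measureReal_le_energyNorm_sub_le [IsProbabilityMeasure P]
    (h : IsRandomCoeff P D κ α κmax)
    (hDb : Bornology.IsBounded D) (hm : AEStronglyMeasurable φ P)
    (hφ : ∀ᵐ ω ∂P, IsCellSolution (κ ω) g (φ ω))
    (hKL : IsKL P (meanCoeff P κ) φ lam ζ) {Q : ℕ} {c : Ω → Fin Q → ℝ}
    (hc : ∀ᵐ ω ∂P, (galerkinMatrix (κ ω) ζ Q).mulVec (c ω) =
      galerkinLoad (κ ω) ζ (meanField P φ) Q) {C₁ β C₂ : ℝ} (hC₁ : 0 < C₁) (hβ : 1 < β)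
    (hlam : ∀ q, lam q ≤ C₁ * β ^ (-((q : ℤ) + 1)))
    (hC₂ : ∀ᵐ ω ∂P, ∀ᵐ x ∂(volume.restrict D), (C₂ • meanCoeff P κ x - κ ω x).PosSemidef)
    {ε : ℝ} (hε : 0 < ε) :
    P.real {ω | ε ≤ energyNorm (κ ω) (φ ω - reducedBasisFun ζ (meanField P φ) (c ω))} ≤
      C₁ * C₂ ^ 2 * β ^ (-(Q : ℤ)) / ((β - 1) * ε ^ 2) := by
  obtain ⟨i⟩ := nonempty_fin_of_isKL hKL
  obtain ⟨R, hR, hD⟩ := hDb.subset_closedBall_lt 0 0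
  obtain ⟨K, hK⟩ := h.exists_ae_norm_le hR.le hD i hφ
  have hint := h.integrable_of_isCellSolution hDb i hm hφ
  have hbar := meanField_sub_mem_H10 hint hφ
  have hmem : ∀ᵐ ω ∂P, φ ω - meanField P φ ∈ H10 D := by
    filter_upwards [hφ] with ω hω
    simpa using sub_mem hω.boundary hbar
  have hK' : ∀ᵐ ω ∂P, ‖φ ω - meanField P φ‖ ≤ K + ‖meanField P φ‖ := by
    filter_upwards [hK] with ω hω
    exact (norm_sub_le _ _).trans (by gcongr)
  have hC₂1 : 1 ≤ C₂ := h.one_le_of_ae_le_meanCoeff hC₂ (u := ζ 0)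
    (by rw [hKL.orthonormal, if_pos rfl])
  have hC₂0 : 0 < C₂ := one_pos.trans_le hC₂1
  have hβ1 : 0 < β - 1 := sub_pos.2 hβ
  have hβ0 : 0 < β := one_pos.trans hβ
  -- The error event need not be measurable, since `c` is arbitrary; Markov is applied to the tail
  -- event that contains it up to a null set.
  have hsub : ∀ᵐ ω ∂P, ε ≤ energyNorm (κ ω) (φ ω - reducedBasisFun ζ (meanField P φ) (c ω)) →
      ENNReal.ofReal (ε ^ 2 / C₂) ≤ klTail P (meanCoeff P κ) φ ζ Q ω := by
    filter_upwards [ae_ofReal_energy_sub_le_klTail h hm hK' hmem hR.le hD i hKL, hφ, hc,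
      h.ae_isBddCoeff, h.ae_energy_comm, h.ae_energy_nonneg, h.ae_energy_le_meanCoeff hC₂]
      with ω h1 h2 h3 h4 h5 h6 h7 hle
    obtain ⟨b, hb⟩ := h1 Q
    refine le_trans (ENNReal.ofReal_le_ofReal ?_) hb
    rw [div_le_iff₀' hC₂0]
    exact ((Real.le_sqrt' hε).1 hle).trans
      ((h2.energy_sub_reducedBasisFun_le h4 h5 h6 hKL.mem h3 b).trans (h7 _))
  have hpos : 0 < ε ^ 2 / C₂ := by positivity
  have htail : ∫⁻ ω, klTail P (meanCoeff P κ) φ ζ Q ω ∂P ≤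
      ENNReal.ofReal (C₁ * β ^ (-(Q : ℤ)) / (β - 1)) := by
    rw [lintegral_klTail h hm hK' hKL, ← tsum_ofReal_const_mul_zpow hC₁ hβ]
    exact ENNReal.tsum_le_tsum fun k => ENNReal.ofReal_le_ofReal (hlam _)
  refine ENNReal.toReal_le_of_le_ofReal (by positivity) ?_
  calc P {ω | ε ≤ energyNorm (κ ω) (φ ω - reducedBasisFun ζ (meanField P φ) (c ω))}
      ≤ P {ω | ENNReal.ofReal (ε ^ 2 / C₂) ≤ klTail P (meanCoeff P κ) φ ζ Q ω} :=
        measure_mono_ae hsub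
    _ ≤ (∫⁻ ω, klTail P (meanCoeff P κ) φ ζ Q ω ∂P) / ENNReal.ofReal (ε ^ 2 / C₂) :=
        meas_ge_le_lintegral_div (aemeasurable_klTail h hm Q)
          (ENNReal.ofReal_pos.2 hpos).ne' ENNReal.ofReal_ne_top
    _ ≤ ENNReal.ofReal (C₁ * β ^ (-(Q : ℤ)) / (β - 1)) / ENNReal.ofReal (ε ^ 2 / C₂) := by
        gcongr
    _ = ENNReal.ofReal (C₁ * C₂ * β ^ (-(Q : ℤ)) / ((β - 1) * ε ^ 2)) := by
        rw [← ENNReal.ofReal_div_of_pos hpos]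
        congr 1
        field_simp
    -- Here `C₂ ≤ C₂ ^ 2`, by `1 ≤ C₂`.
    _ ≤ _ := by
        gcongr
        nlinarith

end Main

end StoMsFEM
end

open StoMsFEM in
theorem theorem3p3 (d : ℕ) (D : Set (Space d)) (hDo : IsOpen D) (hDb : Bornology.IsBounded D)
    (L : ℕ) (p : Fin L → Pair d D) (hp : ∀ l, MemH1 (p l)) :
    -- the constant depends only on the domain and on the boundary conditions
    ∃ Cφ : ℝ, 0 < Cφ ∧
      ∀ (Ω : Type*) [MeasurableSpace Ω] (P : Measure Ω) [IsProbabilityMeasure P]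
        (κ : Ω → Coeff d) (α κmax : ℝ) (_ : IsRandomCoeff P D κ α κmax)
        -- the multiscale basis functions
        (φ : Fin L → Ω → Pair d D) (_ : ∀ l, AEStronglyMeasurable (φ l) P)
        (_ : ∀ l, ∀ᵐ ω ∂P, IsCellSolution (κ ω) (p l) (φ l ω))
        -- their Karhunen-Loeve energies and modes
        (lam : Fin L → ℕ → ℝ) (ζ : Fin L → ℕ → Pair d D)
        (_ : ∀ l, IsKL P (meanCoeff P κ) (φ l) (lam l) (ζ l))
        -- the Galerkin coefficients and the reduced-basis solutions
        (Q : ℕ) (c : Fin L → Ω → Fin Q → ℝ)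
        (_ : ∀ l, ∀ᵐ ω ∂P, (galerkinMatrix (κ ω) (ζ l) Q).mulVec (c l ω) =
          galerkinLoad (κ ω) (ζ l) (meanField P (φ l)) Q)
        (φrb : Fin L → Ω → Pair d D)
        (_ : ∀ l ω, φrb l ω = reducedBasisFun (ζ l) (meanField P (φ l)) (c l ω))
        -- the two assumptions; index `q` here is index `j = q + 1` of a count from one
        (C₁ β C₂ : ℝ) (_ : 0 < C₁) (_ : 1 < β)
        (_ : ∀ l q, lam l q ≤ C₁ * β ^ (-((q : ℤ) + 1)))
        (_ : ∀ᵐ ω ∂P, ∀ᵐ x ∂(volume.restrict D),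
          (C₂ • meanCoeff P κ x - κ ω x).PosSemidef),
        (∀ l, ∀ᵐ ω ∂P, energyNorm (κ ω) (φ l ω) ≤ Cφ * √κmax) ∧
        (∀ ε : ℝ, 0 < ε → ∀ l,
          P.real {ω | ε ≤ energyNorm (κ ω) (φ l ω - φrb l ω)} ≤
            C₁ * C₂ ^ 2 * β ^ (-(Q : ℤ)) / ((β - 1) * ε ^ 2)) ∧
        (∀ ε : ℝ, 0 < ε → ε ≤ 2 * Cφ * √κmax → ∀ l l',
          P.real {ω | 2 * Cφ * √κmax * ε ≤
              |energy (κ ω) (φ l ω) (φ l' ω) - energy (κ ω) (φrb l ω) (φrb l' ω)|} ≤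
            2 * C₁ * C₂ ^ 2 * β ^ (-(Q : ℤ)) / ((β - 1) * ε ^ 2)) := by
  -- The sum bounds every `‖∇p l‖`; the `1` ensures positivity.
  refine ⟨1 + ∑ l, ‖(p l).snd‖, by positivity, ?_⟩
  intro Ω _ P _ κ α κmax hκ φ hm hφ lam ζ hKL Q c hc φrb hrb C₁ β C₂ hC₁ hβ hlam hC₂
  set Cφ := 1 + ∑ l, ‖(p l).snd‖
  have hCφ : 0 < Cφ := by positivity
  have herr : ∀ ε : ℝ, 0 < ε → ∀ l, P.real {ω | ε ≤ energyNorm (κ ω) (φ l ω - φrb l ω)} ≤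
      C₁ * C₂ ^ 2 * β ^ (-(Q : ℤ)) / ((β - 1) * ε ^ 2) := fun ε hε l => by
    simp only [hrb]
    exact measureReal_le_energyNorm_sub_le hκ hDb (hm l) (hφ l) (hKL l) (hc l) hC₁ hβ (hlam l)
      hC₂ hε
  refine ⟨fun l => ?_, herr, fun ε hε hεle l l' => ?_⟩
  · refine ae_energyNorm_le hκ (hφ l) ?_
    exact (Finset.single_le_sum (f := fun l => ‖(p l).snd‖) (fun _ _ => norm_nonneg _)
      (Finset.mem_univ l)).trans (le_add_of_nonneg_left zero_le_one)
  · obtain ⟨i⟩ := nonempty_fin_of_isKL (hKL l)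
    have hbar : ∀ l, meanField P (φ l) - p l ∈ H10 D := fun l =>
      meanField_sub_mem_H10 (hκ.integrable_of_isCellSolution hDb i (hm l) (hφ l)) (hφ l)
    set E : Fin L → Set Ω := fun l => {ω | ε ≤ energyNorm (κ ω) (φ l ω - φrb l ω)}
    set S : Set Ω := {ω | 2 * Cφ * √κmax * ε ≤
      |energy (κ ω) (φ l ω) (φ l' ω) - energy (κ ω) (φrb l ω) (φrb l' ω)|}
    have hsub : S ≤ᵐ[P] (E l ∪ E l' : Set Ω) := by
      filter_upwards [hφ l, hφ l', hκ.ae_isBddCoeff, hκ.ae_energy_comm, hκ.ae_energy_nonneg]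
        with ω h1 h2 h3 h4 h5 hω
      have h6 : 2 * Cφ * √κmax * ε ≤
        |energy (κ ω) (φ l ω) (φ l' ω) - energy (κ ω) (φrb l ω) (φrb l' ω)| := hω
      rw [energy_sub_energy_eq h3 h4 h1 h2
        (by rw [hrb]; exact h1.sub_reducedBasisFun_mem (hKL l).mem (hbar l) _)
        (by rw [hrb]; exact h2.sub_reducedBasisFun_mem (hKL l').mem (hbar l') _), abs_neg] at h6
      have h7 := h6.trans (h3.abs_energy_le h4 h5 _ _)
      by_contra hcon
      have h8 : energyNorm (κ ω) (φ l ω - φrb l ω) < ε := not_le.1 fun h => hcon (.inl h)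
      have h9 : energyNorm (κ ω) (φ l' ω - φrb l' ω) < ε := not_le.1 fun h => hcon (.inr h)
      -- If both errors were below `ε`, their product would be below `ε * ε ≤ 2 * Cφ * √κmax * ε`;
      -- this is where the upper bound on `ε` enters.
      have h10 := mul_lt_mul'' h8 h9 (Real.sqrt_nonneg _) (Real.sqrt_nonneg _)
      have h11 := mul_le_mul_of_nonneg_right hεle hε.le
      linarith
    calc P.real S ≤ P.real (E l ∪ E l') :=
          ENNReal.toReal_mono (measure_ne_top _ _) (measure_mono_ae hsub)
      _ ≤ P.real (E l) + P.real (E l') := measureReal_union_le _ _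
      _ ≤ _ := add_le_add (herr ε hε l) (herr ε hε l')
      _ = _ := by ring
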